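/- For a finite set $A \subseteq \mathbb{R}$, let $A - A = \{|a-b| : a, b \in A,\ a \neq b\}$ denote the set of its positive differences. For integers $n \geq k \geq 1$ and $\ell \geq 0$, let $g(n,k,\ell)$ be the minimum of $|A-A|$ over all $n$-element sets $A \subseteq \mathbb{R}$ such that $|A'-A'| \geq \ell$ for every $k$-element subset $A' \subseteq A$ (with $g(n,k,\ell) = +\infty$ if no such $A$ exists). Theorem. For every positive integer $k$ and every real number $c$ with $1 < c \leq 2$, $$g\left(n,\, k,\, \left\lceil \frac{(c-1)(k-1)}{c} \right\rceil^{2}\right) = o(n^c) \qquad (n \to \infty, \text{ with } k \text{ and } c \text{ fixed}).$$ In particular, the left-hand side is finite for all sufficiently large $n$. -/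

import Mathlib

namespace DiffLocal

/-- The difference set of a finite set of reals, with only positive differences included:
`{|a - b| : a, b ∈ A, a ≠ b}`. -/
noncomputable def diffSet (A : Finset ℝ) : Finset ℝ :=
  A.offDiag.image fun p => |p.1 - p.2|

/-- The `(k, ℓ)`-local property: every `k`-element subset of `A` spans at least `ℓ` distinct
positive differences. -/
def HasLocalProperty (k ℓ : ℕ) (A : Finset ℝ) : Prop :=
  ∀ B : Finset ℝ, B ⊆ A → B.card = k → ℓ ≤ (diffSet B).card

/-- `g n k ℓ` is the minimum number of distinct positive differences over all `n`-element sets of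
reals with the `(k, ℓ)`-local property, and `⊤` if there are no such sets. The infimum is attained
as soon as there is such a set, because `ℕ∞` is well-ordered. -/
noncomputable def g (n k ℓ : ℕ) : ℕ∞ :=
  ⨅ (A : Finset ℝ) (_ : A.card = n) (_ : HasLocalProperty k ℓ A), ((diffSet A).card : ℕ∞)

end DiffLocal

/-!
The set is a random subset of an interval `[0, N)` with `N ≈ n ^ b`, where `b < c` is close to `c`,
from which one point of each bad `k`-element subset is deleted. It has at most `N = o(n ^ c)`
differences. Put `D = ⌈(c - 1) (k - 1) / c⌉`, so that bad means fewer than `D ^ 2` differences. If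
there are only `O(N ^ D)` bad subsets, a random set with about `2 n` points contains
`O(N ^ D (n / N) ^ k)` of them on average, and this is less than `n` because `c (k - D) > k - 1`.

The count of bad sets rests on a Freiman-type inequality. Since `c ≤ 2`, one has `2 * D ≤ k`, and a
set of at least `2 * D` reals with fewer than `D ^ 2` positive differences has at most `D` degrees
of freedom: some `D` of its elements determine all others, once the relations `a + b = c + d` in it
are prescribed (`exists_determines_card_le`). There are boundedly many systems of relations, hence
`O(N ^ D)` bad sets (`card_badSets_le`).

For exactly `2 * D` elements this follows from `exists_determines_choose_le`: if `r` elements of `B`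
are redundant, then `B` has at least `|B| (|B| - 1) / 2 - r (r + 1)` differences. The proof removes
the smallest element `p`. If some difference `q - p` recurs among the remaining elements, then `p`
is redundant, and it must be shown that at most `2 * r` such `q` exist. Each satisfies a relation
`q + x = p + y`. Those `q` with some partner `x > q` are determined by larger elements and `p`;
those without are determined by larger elements, `p` and the former kind. So each of the two kinds
is redundant as a whole (`determines_sdiff_repeatedSmall`,
`determines_sdiff_repeated_sdiff_repeatedSmall`), and has at most `r` elements if `r` is maximal.
-/

namespace DiffLocal

open Finset

/-! ### Freiman rank and the number of differences -/

/-- `φ` respects every additive relation `a + b = c + d` inside `B`: it restricts to a Freiman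
homomorphism of order two on `B`. Values outside `B` are irrelevant. The values of such `φ` on `B`
form a linear space of dimension one more than the Freiman rank of `B`. -/
def IsFreimanHom (B : Finset ℝ) (φ : ℝ → ℝ) : Prop :=
  ∀ a ∈ B, ∀ b ∈ B, ∀ c ∈ B, ∀ d ∈ B, a + b = c + d → φ a + φ b = φ c + φ d

/-- Values on `S` determine a Freiman homomorphism on `B`. By linearity it is enough to ask this
for the value zero. -/
def Determines (S B : Finset ℝ) : Prop :=
  ∀ φ : ℝ → ℝ, IsFreimanHom B φ → (∀ s ∈ S, φ s = 0) → ∀ b ∈ B, φ b = 0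

lemma IsFreimanHom.mono {A B : Finset ℝ} {φ : ℝ → ℝ} (h : IsFreimanHom B φ) (hAB : A ⊆ B) :
    IsFreimanHom A φ :=
  fun a ha b hb c hc d hd => h a (hAB ha) b (hAB hb) c (hAB hc) d (hAB hd)

lemma mem_diffSet {A : Finset ℝ} {t : ℝ} :
    t ∈ diffSet A ↔ 0 < t ∧ ∃ x ∈ A, ∃ y ∈ A, y = x + t := by
  simp only [diffSet, mem_image, mem_offDiag, Prod.exists]
  constructor
  · rintro ⟨a, b, ⟨ha, hb, hab⟩, rfl⟩
    refine ⟨abs_pos.2 (sub_ne_zero.2 hab), ?_⟩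
    rcases le_total a b with h | h
    · exact ⟨a, ha, b, hb, by rw [abs_of_nonpos (by linarith)]; ring⟩
    · exact ⟨b, hb, a, ha, by rw [abs_of_nonneg (by linarith)]; ring⟩
  · rintro ⟨ht, x, hx, y, hy, rfl⟩
    exact ⟨x + t, x, ⟨hy, hx, by linarith⟩, by rw [add_sub_cancel_left, abs_of_pos ht]⟩

lemma diffSet_mono {A B : Finset ℝ} (h : A ⊆ B) : diffSet A ⊆ diffSet B := by
  intro t
  simp only [mem_diffSet]
  rintro ⟨ht, x, hx, y, hy, rfl⟩
  exact ⟨ht, x, h hx, _, h hy, rfl⟩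

/-- The elements `q` of `A` that take part in a relation `q + x = p + y` with `x, y ∈ A`. If `p` is
below `A`, every other `q ∈ A` contributes a difference `q - p` that does not occur in `A`. -/
noncomputable def repeated (p : ℝ) (A : Finset ℝ) : Finset ℝ := by
  classical exact A.filter fun q => ∃ x ∈ A, ∃ y ∈ A, q + x = p + y

/-- The elements of `repeated p A` with a relation `q + x = p + y` in which `q` is smaller than its
partner `x`. -/
noncomputable def repeatedSmall (p : ℝ) (A : Finset ℝ) : Finset ℝ := by
  classical exact A.filter fun q => ∃ x ∈ A, ∃ y ∈ A, q + x = p + y ∧ q < x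

lemma mem_repeated {p : ℝ} {A : Finset ℝ} {q : ℝ} :
    q ∈ repeated p A ↔ q ∈ A ∧ ∃ x ∈ A, ∃ y ∈ A, q + x = p + y := by
  simp [repeated]

lemma mem_repeatedSmall {p : ℝ} {A : Finset ℝ} {q : ℝ} :
    q ∈ repeatedSmall p A ↔ q ∈ A ∧ ∃ x ∈ A, ∃ y ∈ A, q + x = p + y ∧ q < x := by
  simp [repeatedSmall]

lemma card_diffSet_insert {p : ℝ} {A : Finset ℝ} (hp : ∀ x ∈ A, p < x) :
    (diffSet A).card + A.card ≤ (diffSet (insert p A)).card + (repeated p A).card := by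
  classical
  have hN : repeated p A ⊆ A := fun q hq => (mem_repeated.1 hq).1
  have hsub : diffSet A ∪ (A \ repeated p A).image (fun q => q - p) ⊆ diffSet (insert p A) := by
    apply union_subset (diffSet_mono (subset_insert _ _))
    intro t ht
    obtain ⟨q, hq, rfl⟩ := mem_image.1 ht
    have hqA := (mem_sdiff.1 hq).1
    exact mem_diffSet.2 ⟨by linarith [hp q hqA], p, mem_insert_self _ _, q,
      mem_insert_of_mem hqA, by ring⟩
  have hdisj : Disjoint (diffSet A) ((A \ repeated p A).image (fun q => q - p)) := by
    rw [disjoint_left]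
    intro t ht ht'
    obtain ⟨q, hq, rfl⟩ := mem_image.1 ht'
    obtain ⟨-, x, hx, y, hy, hxy⟩ := mem_diffSet.1 ht
    rw [mem_sdiff] at hq
    exact hq.2 (mem_repeated.2 ⟨hq.1, x, hx, y, hy, by linarith⟩)
  have h1 := card_le_card hsub
  rw [card_union_of_disjoint hdisj, card_image_of_injective _ (sub_left_injective)] at h1
  have h2 := card_sdiff_add_card_eq_card hN
  omega

lemma Determines.insert {S A : Finset ℝ} (h : Determines S A) (p : ℝ) :
    Determines (insert p S) (insert p A) := by
  intro φ hφ h0 b hb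
  rcases mem_insert.1 hb with rfl | hb
  · exact h0 _ (mem_insert_self _ _)
  · exact h φ (hφ.mono (subset_insert _ _)) (fun s hs => h0 s (mem_insert_of_mem hs)) b hb

lemma Determines.insert_right {S A : Finset ℝ} (h : Determines S A) {p : ℝ}
    (hN : (repeated p A).Nonempty) : Determines S (Insert.insert p A) := by
  intro φ hφ h0
  have hA := h φ (hφ.mono (subset_insert _ _)) h0
  intro b hb
  rcases mem_insert.1 hb with rfl | hb
  · obtain ⟨q, hq⟩ := hN
    obtain ⟨hq, x, hx, y, hy, hxy⟩ := mem_repeated.1 hq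
    have := hφ q (mem_insert_of_mem hq) x (mem_insert_of_mem hx) b (mem_insert_self _ _) y
      (mem_insert_of_mem hy) hxy
    rw [hA q hq, hA x hx, hA y hy] at this
    linarith
  · exact hA b hb

/-- To see that the complement of `R` determines `B`, it is enough to recover the value at each
`b ∈ R` from the values at larger elements and at elements outside `R`. -/
lemma determines_sdiff {B R : Finset ℝ}
    (hR : ∀ φ, IsFreimanHom B φ → ∀ b ∈ B, b ∈ R → (∀ a ∈ B, b < a ∨ a ∉ R → φ a = 0) → φ b = 0) :
    Determines (B \ R) B := by
  intro φ hφ h0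
  by_contra! hcon
  obtain ⟨b₀, hb₀, hne₀⟩ := hcon
  classical
  obtain ⟨b, hb, hmax⟩ := (B.filter fun b => φ b ≠ 0).exists_max_image id
    ⟨b₀, mem_filter.2 ⟨hb₀, hne₀⟩⟩
  rw [mem_filter] at hb
  refine hb.2 (hR φ hφ b hb.1 ?_ ?_)
  · by_contra hbR
    exact hb.2 (h0 b (mem_sdiff.2 ⟨hb.1, hbR⟩))
  · rintro a ha (hab | haR)
    · by_contra hne
      exact absurd (hmax a (mem_filter.2 ⟨ha, hne⟩)) (not_le.2 hab)
    · exact h0 a (mem_sdiff.2 ⟨ha, haR⟩)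

/-- If `q + x = p + y` with `p < q < x`, both `x` and `y` are larger than `q`, so `φ q` is recovered
from larger elements and `p`. -/
lemma determines_sdiff_repeatedSmall {p : ℝ} {A : Finset ℝ} (hp : ∀ x ∈ A, p < x) :
    Determines (insert p A \ repeatedSmall p A) (insert p A) := by
  refine determines_sdiff fun φ hφ b hb hbR h => ?_
  obtain ⟨hbA, x, hx, y, hy, hxy, hbx⟩ := mem_repeatedSmall.1 hbR
  have e := hφ b hb x (mem_insert_of_mem hx) p (mem_insert_self _ _) y (mem_insert_of_mem hy) hxy
  have hpb := hp b hbA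
  rw [h x (mem_insert_of_mem hx) (Or.inl hbx), h y (mem_insert_of_mem hy) (Or.inl (by linarith)),
    h p (mem_insert_self _ _) (Or.inr fun hps => (hp p (mem_repeatedSmall.1 hps).1).false)] at e
  linarith

/-- If `q` is never smaller than its partner, then in `q + x = p + y` the element `y` is larger than
`q`, while `x` is either `q` itself or smaller than its partner `q`, hence not in the removed set. -/
lemma determines_sdiff_repeated_sdiff_repeatedSmall {p : ℝ} {A : Finset ℝ} (hp : ∀ x ∈ A, p < x) :
    Determines (insert p A \ (repeated p A \ repeatedSmall p A)) (insert p A) := by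
  refine determines_sdiff fun φ hφ b hb hbR h => ?_
  obtain ⟨hbN, hbs⟩ := mem_sdiff.1 hbR
  obtain ⟨hbA, x, hx, y, hy, hxy⟩ := mem_repeated.1 hbN
  have e := hφ b hb x (mem_insert_of_mem hx) p (mem_insert_self _ _) y (mem_insert_of_mem hy) hxy
  have hpx := hp x hx
  have hxb : x ≤ b := not_lt.1 fun hlt => hbs (mem_repeatedSmall.2 ⟨hbA, x, hx, y, hy, hxy, hlt⟩)
  rw [h y (mem_insert_of_mem hy) (Or.inl (by linarith)), h p (mem_insert_self _ _)
    (Or.inr fun hps => (hp p (mem_repeated.1 (mem_sdiff.1 hps).1).1).false)] at e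
  rcases hxb.eq_or_lt with rfl | hlt
  · linarith
  · rw [h x (mem_insert_of_mem hx) (Or.inr fun hxR => (mem_sdiff.1 hxR).2
      (mem_repeatedSmall.2 ⟨hx, b, hbA, y, hy, by linarith, hlt⟩))] at e
    linarith

/-- The larger of the two halves of `repeated p A` can be left out of a determining set. -/
lemma exists_determines_repeated {p : ℝ} {A : Finset ℝ} (hp : ∀ x ∈ A, p < x) :
    ∃ R ⊆ A, (repeated p A).card ≤ 2 * R.card ∧ Determines (insert p A \ R) (insert p A) := by
  have hsN : repeatedSmall p A ⊆ repeated p A := fun q hq => by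
    obtain ⟨hq, x, hx, y, hy, hxy, -⟩ := mem_repeatedSmall.1 hq
    exact mem_repeated.2 ⟨hq, x, hx, y, hy, hxy⟩
  have hNA : repeated p A ⊆ A := fun q hq => (mem_repeated.1 hq).1
  have hc := card_sdiff_add_card_eq_card hsN
  rcases le_total (repeated p A \ repeatedSmall p A).card (repeatedSmall p A).card with h | h
  · exact ⟨_, hsN.trans hNA, by omega, determines_sdiff_repeatedSmall hp⟩
  · exact ⟨_, sdiff_subset.trans hNA, by omega, determines_sdiff_repeated_sdiff_repeatedSmall hp⟩

/-- With `r = |B| - |S|`, at most `r (r + 1)` of the pairs of `B` are lost to coincidences of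
differences. Symmetric sets `{±e₁, …, ±eₘ}` with independent `eᵢ` are extremal. -/
lemma exists_determines_choose_le (B : Finset ℝ) :
    ∃ S ⊆ B, Determines S B ∧ B.card.choose 2 ≤
      (diffSet B).card + (B.card - S.card) * (B.card - S.card + 1) := by
  induction B using Finset.induction_on_min with
  | empty => exact ⟨∅, Subset.rfl, fun φ _ _ b hb => by simp at hb, by simp⟩
  | insert p A hp ih =>
    obtain ⟨S, hSA, hS, hle⟩ := ih
    have hpA : p ∉ A := fun h => (hp p h).false
    have hB : (insert p A).card = A.card + 1 := card_insert_of_notMem hpA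
    have hch : (A.card + 1).choose 2 = A.card + A.card.choose 2 := by
      rw [Nat.choose_succ_succ' A.card 1, Nat.choose_one_right]
    have hd := card_diffSet_insert hp
    have hSc := card_le_card hSA
    rw [hB, hch]
    rcases (repeated p A).eq_empty_or_nonempty with hN | hN
    · refine ⟨insert p S, insert_subset_insert _ hSA, hS.insert p, ?_⟩
      rw [card_insert_of_notMem fun h => hpA (hSA h), Nat.add_sub_add_right]
      rw [hN, card_empty] at hd
      omega
    · obtain ⟨m, hm'⟩ : ∃ m, A.card - S.card = m := ⟨_, rfl⟩
      rw [hm'] at hle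
      obtain ⟨R, hRA, hNR, hR⟩ := exists_determines_repeated hp
      -- Determining sets need not be minimal, so `S` may be too large for the bound on `repeated`;
      -- in that case the complement of `R` is the better choice.
      by_cases hbig : m + 1 ≤ R.card
      · refine ⟨insert p A \ R, sdiff_subset, hR, ?_⟩
        have hRB : R ⊆ insert p A := hRA.trans (subset_insert _ _)
        have := card_sdiff_add_card_eq_card hRB
        rw [show A.card + 1 - (insert p A \ R).card = R.card by omega]
        have : m * (m + 1) + 2 * R.card ≤ R.card * (R.card + 1) := by nlinarith
        omega
      · refine ⟨S, hSA.trans (subset_insert _ _), hS.insert_right hN, ?_⟩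
        rw [show A.card + 1 - S.card = m + 1 by omega]
        have : (m + 1) * (m + 1 + 1) = m * (m + 1) + 2 * (m + 1) := by ring
        omega

/-- A set of at least `2 * D` reals with fewer than `D ^ 2` differences has at most `D` degrees of
freedom. -/
lemma exists_determines_card_le (B : Finset ℝ) :
    ∀ D : ℕ, 2 * D ≤ B.card → (diffSet B).card < D ^ 2 →
      ∃ S ⊆ B, S.card ≤ D ∧ Determines S B := by
  have base : ∀ (B : Finset ℝ) (D : ℕ), 2 * D = B.card → (diffSet B).card < D ^ 2 →
      ∃ S ⊆ B, S.card ≤ D ∧ Determines S B := by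
    intro B D hD hlt
    obtain ⟨S, hSB, hS, hle⟩ := exists_determines_choose_le B
    refine ⟨S, hSB, ?_, hS⟩
    by_contra! hcon
    obtain ⟨d, rfl⟩ : ∃ d, D = d + 1 := Nat.exists_eq_succ_of_ne_zero (by rintro rfl; simp at hlt)
    have h1 : B.card - S.card ≤ d := by omega
    have h2 : (B.card - S.card) * (B.card - S.card + 1) ≤ d * (d + 1) := by gcongr
    have h3 : B.card.choose 2 = (d + 1) * (2 * d + 1) := by
      rw [← hD, Nat.choose_two_right, show 2 * (d + 1) - 1 = 2 * d + 1 by omega, mul_assoc,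
        Nat.mul_div_cancel_left _ two_pos]
    nlinarith
  induction B using Finset.induction_on_min with
  | empty => exact fun D hD hlt => base _ D (by simpa using hD) hlt
  | insert p A hp ih =>
    intro D hD hlt
    rcases hD.eq_or_lt with h | h
    · exact base _ D h hlt
    have hpA : p ∉ A := fun h => (hp p h).false
    rw [card_insert_of_notMem hpA] at h
    have hd := card_diffSet_insert hp
    rcases (repeated p A).eq_empty_or_nonempty with hN | hN
    -- All `A.card ≥ 2 * D` differences at `p` are new, which leaves fewer than `(D - 1) ^ 2` for `A`.
    · rw [hN, card_empty] at hd
      obtain ⟨d, rfl⟩ : ∃ d, D = d + 1 := Nat.exists_eq_succ_of_ne_zero (by rintro rfl; simp at hlt)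
      obtain ⟨S, hSA, hSc, hS⟩ := ih d (by omega) (by nlinarith)
      exact ⟨insert p S, insert_subset_insert _ hSA, (card_insert_le _ _).trans (by omega),
        hS.insert p⟩
    · obtain ⟨S, hSA, hSc, hS⟩ := ih D (by omega)
        ((card_le_card (diffSet_mono (subset_insert _ _))).trans_lt hlt)
      exact ⟨S, hSA.trans (subset_insert _ _), hSc, hS.insert_right hN⟩

/-! ### Counting sets with few differences -/

/-- A set of integers in `[0, N)`, as a set of reals. -/
noncomputable def toReals {N : ℕ} (e : Finset (Fin N)) : Finset ℝ :=
  e.image fun i : Fin N => ((i : ℕ) : ℝ)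

lemma natCast_fin_injective (N : ℕ) : Function.Injective fun i : Fin N => ((i : ℕ) : ℝ) :=
  Nat.cast_injective.comp Fin.val_injective

lemma card_toReals {N : ℕ} (e : Finset (Fin N)) : (toReals e).card = e.card :=
  card_image_of_injective _ (natCast_fin_injective N)

/-- The `k`-element subsets of `[0, N)` with fewer than `ℓ` differences. -/
noncomputable def badSets (N k ℓ : ℕ) : Finset (Finset (Fin N)) :=
  univ.filter fun e => e.card = k ∧ (diffSet (toReals e)).card < ℓ

/-- The additive relations satisfied by a sequence of reals, as a set of indices. -/
def sumPattern {k : ℕ} (b : Fin k → ℝ) : Set (Fin k × Fin k × Fin k × Fin k) :=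
  {i | b i.1 + b i.2.1 = b i.2.2.1 + b i.2.2.2}

/-- Two sequences with the same additive relations coincide as soon as they agree on a determining
set: their difference is a Freiman homomorphism. -/
lemma eq_of_sumPattern_eq {k : ℕ} {b b' : Fin k → ℝ} (hb : Function.Injective b)
    (hP : sumPattern b = sumPattern b') {S : Finset ℝ} (hS : Determines S (univ.image b))
    (h : ∀ i, b i ∈ S → b i = b' i) (hSb : S ⊆ univ.image b) : b = b' := by
  let φ : ℝ → ℝ := Function.extend b (fun i => b' i - b i) 0
  have hφ : ∀ i, φ (b i) = b' i - b i := fun i => hb.extend_apply _ _ i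
  have hom : IsFreimanHom (univ.image b) φ := by
    intro x hx y hy z hz w hw hxy
    obtain ⟨i, -, rfl⟩ := mem_image.1 hx
    obtain ⟨j, -, rfl⟩ := mem_image.1 hy
    obtain ⟨l, -, rfl⟩ := mem_image.1 hz
    obtain ⟨m, -, rfl⟩ := mem_image.1 hw
    have h1 : (i, j, l, m) ∈ sumPattern b' := hP ▸ (show (i, j, l, m) ∈ sumPattern b from hxy)
    have h2 : b' i + b' j = b' l + b' m := h1
    rw [hφ, hφ, hφ, hφ]
    linarith
  have h0 := hS φ hom fun s hs => by
    obtain ⟨i, -, rfl⟩ := mem_image.1 (hSb hs)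
    rw [hφ, h i hs, sub_self]
  funext i
  have := h0 (b i) (mem_image_of_mem _ (mem_univ i))
  rw [hφ] at this
  linarith

/-- A bad set, listed as `b : Fin k → Fin N`, is encoded by its additive relations, the positions
`t : Fin D → Fin k` of `D` determining entries, and the values of these entries. -/
lemma card_badSets_le {N k D : ℕ} (hD : 2 * D ≤ k) :
    (badSets N k (D ^ 2)).card ≤
      Fintype.card (Set (Fin k × Fin k × Fin k × Fin k)) * Fintype.card (Fin D → Fin k) * N ^ D := by
  classical
  have key : ∀ e : {e // e ∈ badSets N k (D ^ 2)}, ∃ (b : Fin k → Fin N) (t : Fin D → Fin k),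
      univ.image b = e.1 ∧ Function.Injective b ∧
        ∃ S ⊆ univ.image (fun i => ((b i : ℕ) : ℝ)),
          Determines S (univ.image (fun i => ((b i : ℕ) : ℝ))) ∧
          ∀ s ∈ S, ∃ j, ((b (t j) : ℕ) : ℝ) = s := by
    rintro ⟨e, he⟩
    obtain ⟨-, hek, hlt⟩ := mem_filter.1 he
    have hr : (toReals e).card = k := (card_toReals e).trans hek
    obtain ⟨S, hSe, hSD, hS⟩ := exists_determines_card_le (toReals e) D (by omega) hlt
    obtain ⟨S', hSS', hS'e, hS'D⟩ := exists_subsuperset_card_eq hSe hSD (by omega : D ≤ _)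
    have hb : univ.image (e.orderEmbOfFin hek) = e := image_orderEmbOfFin_univ e hek
    have hbr : univ.image (fun i => ((e.orderEmbOfFin hek i : ℕ) : ℝ)) = toReals e := by
      conv_rhs => rw [toReals, ← hb, image_image]
      rfl
    have ht : ∀ j, ∃ i, ((e.orderEmbOfFin hek i : ℕ) : ℝ) = S'.orderEmbOfFin hS'D j := by
      intro j
      have := hS'e (orderEmbOfFin_mem S' hS'D j)
      rw [← hbr] at this
      simpa using this
    choose t ht using ht
    refine ⟨e.orderEmbOfFin hek, t, hb, (e.orderEmbOfFin hek).injective, S, hbr ▸ hSe,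
      hbr ▸ hS, fun s hs => ?_⟩
    have := hSS' hs
    rw [← image_orderEmbOfFin_univ S' hS'D] at this
    obtain ⟨j, -, hj⟩ := mem_image.1 this
    exact ⟨j, (ht j).trans hj⟩
  choose b t hbe hb S hSb hS hSt using key
  have hinj : Function.Injective fun e =>
      ((sumPattern (fun i => ((b e i : ℕ) : ℝ)), t e), fun j => b e (t e j)) := by
    intro e e' h
    simp only [Prod.mk.injEq] at h
    obtain ⟨⟨hP, ht⟩, hv⟩ := h
    have hbi := (natCast_fin_injective N).comp (hb e)
    have := eq_of_sumPattern_eq hbi hP (hS e) (fun i hi => by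
      obtain ⟨j, hj⟩ := hSt e _ hi
      have hij : t e j = i := hbi hj
      have := congrFun hv j
      simp only [← ht, hij] at this
      simp [this]) (hSb e)
    have hbb : b e = b e' := funext fun i => natCast_fin_injective N (congrFun this i)
    exact Subtype.ext (by rw [← hbe e, ← hbe e', hbb])
  have := Fintype.card_le_of_injective _ hinj
  rwa [Fintype.card_coe, Fintype.card_prod, Fintype.card_prod,
    Fintype.card_fun (α := Fin D) (β := Fin N), Fintype.card_fin, Fintype.card_fin] at this

/-! ### Independent sets in uniform hypergraphs -/

/-- Deletion method: a random vertex set containing each vertex with probability `1 / q` has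
`|α| / q` vertices and `|E| / q ^ k` edges on average. It is realized as the zero set of a uniformly
random function to `Fin q`. -/
lemma exists_independent {α : Type*} [Fintype α] [DecidableEq α] (E : Finset (Finset α))
    {k q n : ℕ} (hE : ∀ e ∈ E, e.card = k) (hk : 1 ≤ k) (hq : 1 ≤ q)
    (h : n * q ^ k + E.card ≤ Fintype.card α * q ^ (k - 1)) :
    ∃ X : Finset α, X.card = n ∧ ∀ e ∈ E, ¬ e ⊆ X := by
  have : NeZero q := ⟨by omega⟩
  let Z : (α → Fin q) → Finset α := fun f => univ.filter fun v => f v = 0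
  have count : ∀ e : Finset α,
      (univ.filter fun f : α → Fin q => e ⊆ Z f).card * q ^ e.card = q ^ Fintype.card α := by
    intro e
    have : (univ.filter fun f : α → Fin q => e ⊆ Z f) =
        Fintype.piFinset fun v => if v ∈ e then {0} else univ := by
      ext f
      simp only [mem_filter, mem_univ, true_and, Fintype.mem_piFinset, Z, subset_iff]
      refine forall_congr' fun v => ?_
      by_cases hv : v ∈ e <;> simp [hv]
    rw [this, Fintype.card_piFinset]
    have h2 : ∀ v, (if v ∈ e then ({0} : Finset (Fin q)) else univ).card
        = if v ∈ eᶜ then q else 1 := by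
      intro v
      by_cases hv : v ∈ e <;> simp [hv]
    rw [prod_congr rfl fun v _ => h2 v, prod_ite_mem, univ_inter, prod_const, ← pow_add,
      card_compl_add_card]
  have hX : ∃ f, n + (E.filter fun e => e ⊆ Z f).card ≤ (Z f).card := by
    by_contra! hcon
    have hsum : ∑ f, (Z f).card < ∑ f, (n + (E.filter fun e => e ⊆ Z f).card) :=
      sum_lt_sum_of_nonempty univ_nonempty fun f _ => hcon f
    have h1 : (∑ f, (Z f).card) * q = Fintype.card α * q ^ Fintype.card α := by
      have : ∑ f, (Z f).card = ∑ v : α, (univ.filter fun f : α → Fin q => {v} ⊆ Z f).card := by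
        simp only [Z, card_filter, singleton_subset_iff, mem_filter, mem_univ, true_and]
        exact sum_comm
      rw [this, sum_mul, sum_congr rfl fun v _ => by simpa using count {v}]
      simp
    have h2 : (∑ f, (E.filter fun e => e ⊆ Z f).card) * q ^ k = E.card * q ^ Fintype.card α := by
      have : ∑ f, (E.filter fun e => e ⊆ Z f).card =
          ∑ e ∈ E, (univ.filter fun f : α → Fin q => e ⊆ Z f).card := by
        simp only [card_filter]
        exact sum_comm
      rw [this, sum_mul, sum_congr rfl fun e he => by simpa [hE e he] using count e]
      simp
    rw [sum_add_distrib, sum_const, card_univ, Fintype.card_fun, Fintype.card_fin,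
      smul_eq_mul] at hsum
    obtain ⟨j, rfl⟩ : ∃ j, k = j + 1 := Nat.exists_eq_succ_of_ne_zero (by omega)
    rw [Nat.add_sub_cancel] at h
    have h3 := Nat.mul_lt_mul_of_pos_right hsum (pow_pos hq (j + 1))
    have h4 := Nat.mul_le_mul_right (q ^ Fintype.card α) h
    have h5 : (∑ f, (Z f).card) * q ^ (j + 1) = Fintype.card α * q ^ j * q ^ Fintype.card α := by
      rw [pow_succ', ← mul_assoc, h1]; ring
    rw [h5, add_mul, h2] at h3
    nlinarith
  obtain ⟨f, hf⟩ := hX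
  -- Delete one vertex from every edge inside the chosen set.
  have hne : ∀ e ∈ E, e.Nonempty := fun e he => card_pos.1 (by rw [hE e he]; omega)
  choose v hv using fun e : E => hne e.1 e.2
  let R := ((E.filter fun e => e ⊆ Z f).attach.image fun e => v ⟨e.1, (mem_filter.1 e.2).1⟩)
  have hR : n ≤ (Z f \ R).card := by
    have := le_card_sdiff R (Z f)
    have : R.card ≤ (E.filter fun e => e ⊆ Z f).card :=
      card_image_le.trans (card_attach).le
    omega
  obtain ⟨X, hXs, hXn⟩ := exists_subset_card_eq hR
  refine ⟨X, hXn, fun e he heX => ?_⟩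
  have h1 := hXs (heX (hv ⟨e, he⟩))
  exact (mem_sdiff.1 h1).2 (mem_image.2
    ⟨⟨e, mem_filter.2 ⟨he, heX.trans (hXs.trans sdiff_subset)⟩⟩, mem_attach _ _, rfl⟩)

/-! ### Choosing the interval -/

lemma g_le_of_independent {n k ℓ N : ℕ} {X : Finset (Fin N)} (hX : X.card = n)
    (h : ∀ e ∈ badSets N k ℓ, ¬ e ⊆ X) : g n k ℓ ≤ N := by
  classical
  have hloc : HasLocalProperty k ℓ (toReals X) := by
    intro B hB hBk
    by_contra! hlt
    obtain ⟨e, heX, rfl⟩ := subset_image_iff.1 hB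
    refine h e ?_ heX
    exact mem_filter.2 ⟨mem_univ _, (card_toReals e).symm.trans hBk, hlt⟩
  have hsub : diffSet (toReals X) ⊆ toReals (univ : Finset (Fin N)) := by
    intro t ht
    obtain ⟨ht0, x, hx, y, hy, hxy⟩ := mem_diffSet.1 ht
    obtain ⟨i, -, rfl⟩ := mem_image.1 hx
    obtain ⟨j, -, rfl⟩ := mem_image.1 hy
    have hij : (i : ℕ) ≤ j := by
      have : ((i : ℕ) : ℝ) ≤ (j : ℕ) := by linarith
      exact_mod_cast this
    refine mem_image.2 ⟨⟨j - i, by omega⟩, mem_univ _, ?_⟩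
    push_cast [hij]
    linarith
  refine (iInf_le_of_le (toReals X) (iInf_le_of_le ((card_toReals X).trans hX)
    (iInf_le_of_le hloc le_rfl))).trans ?_
  have := card_le_card hsub
  rw [card_toReals, card_univ, Fintype.card_fin] at this
  exact_mod_cast this

/-- Deletion with `q = ⌊N / (2 * n)⌋` produces a set in `[0, N)` as soon as `N ^ (k - D)` exceeds a
constant times `n ^ (k - 1)`. -/
lemma exists_g_le {k D : ℕ} (hk : 1 ≤ k) (hD : 2 * D ≤ k) :
    ∃ C : ℕ, ∀ n N : ℕ, 1 ≤ n → 2 * n ≤ N → C * n ^ (k - 1) ≤ N ^ (k - D) →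
      g n k (D ^ 2) ≤ N := by
  classical
  let C₀ := Fintype.card (Set (Fin k × Fin k × Fin k × Fin k)) * Fintype.card (Fin D → Fin k)
  refine ⟨C₀ * 4 ^ k, fun n N hn hN hC => ?_⟩
  have hq : 1 ≤ N / (2 * n) := (Nat.one_le_div_iff (by omega)).2 hN
  have hqN : N / (2 * n) * (2 * n) ≤ N := Nat.div_mul_le_self _ _
  have hNq : N < (N / (2 * n) + 1) * (2 * n) := by
    rw [mul_comm]; exact Nat.lt_mul_div_succ N (by omega)
  generalize N / (2 * n) = q at hq hqN hNq
  have hN4 : N ≤ 4 * n * q := by nlinarith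
  have hM : (badSets N k (D ^ 2)).card ≤ n * q ^ k := by
    refine (card_badSets_le hD).trans ?_
    refine Nat.le_of_mul_le_mul_right (c := (4 * n) ^ k) ?_ (by positivity)
    calc C₀ * N ^ D * (4 * n) ^ k = C₀ * 4 ^ k * n ^ (k - 1) * (n * N ^ D) := by
          obtain ⟨j, rfl⟩ : ∃ j, k = j + 1 := Nat.exists_eq_succ_of_ne_zero (by omega)
          rw [Nat.add_sub_cancel]; ring
      _ ≤ N ^ (k - D) * (n * N ^ D) := by gcongr
      _ = n * N ^ k := by
          rw [mul_left_comm, ← pow_add, Nat.sub_add_cancel (by omega)]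
      _ ≤ n * (4 * n * q) ^ k := by gcongr
      _ = n * q ^ k * (4 * n) ^ k := by rw [mul_pow]; ring
  obtain ⟨X, hX, hXE⟩ := exists_independent (n := n) (badSets N k (D ^ 2))
    (fun e he => (mem_filter.1 he).2.1) hk hq (by
      rw [Fintype.card_fin]
      calc n * q ^ k + _ ≤ n * q ^ k + n * q ^ k := by gcongr
        _ = q * (2 * n) * q ^ (k - 1) := by
          obtain ⟨j, rfl⟩ : ∃ j, k = j + 1 := Nat.exists_eq_succ_of_ne_zero (by omega)
          rw [Nat.add_sub_cancel]; ring
        _ ≤ N * q ^ (k - 1) := by gcongr)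
  exact g_le_of_independent hX hXE

lemma eventually_le_rpow (K : ℝ) {a : ℝ} (ha : 0 < a) :
    ∀ᶠ n : ℕ in Filter.atTop, K ≤ (n : ℝ) ^ a :=
  ((tendsto_rpow_atTop ha).comp tendsto_natCast_atTop_atTop).eventually_ge_atTop K

/-- The choice of the ceiling: the second bound says that the condition `N ^ (k - D) ≫ n ^ (k - 1)`
holds for `N = n ^ c`, with room to spare in the exponent. -/
lemma ceil_bounds {k : ℕ} (hk : 1 ≤ k) {c : ℝ} (hc₁ : 1 < c) (hc₂ : c ≤ 2) :
    2 * ⌈(c - 1) * ((k : ℝ) - 1) / c⌉₊ ≤ k ∧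
      ((k : ℝ) - 1) < c * ((k : ℝ) - ⌈(c - 1) * ((k : ℝ) - 1) / c⌉₊) := by
  have hk' : (1 : ℝ) ≤ k := by exact_mod_cast hk
  have h0 : 0 ≤ (c - 1) * ((k : ℝ) - 1) / c :=
    div_nonneg (mul_nonneg (by linarith) (by linarith)) (by linarith)
  have h1 := Nat.ceil_lt_add_one h0
  generalize ⌈(c - 1) * ((k : ℝ) - 1) / c⌉₊ = D at h1
  have h2 : (c - 1) * ((k : ℝ) - 1) / c ≤ ((k : ℝ) - 1) / 2 := by
    rw [div_le_div_iff₀ (by linarith) two_pos]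
    nlinarith
  have h3 : c * ((c - 1) * ((k : ℝ) - 1) / c) = (c - 1) * ((k : ℝ) - 1) :=
    mul_div_cancel₀ _ (by linarith)
  constructor
  · have : (2 * D : ℝ) < k + 1 := by linarith
    have : 2 * D < k + 1 := by exact_mod_cast this
    omega
  · nlinarith

end DiffLocal

theorem theorem1p6 (k : ℕ) (hk : 1 ≤ k) (c : ℝ) (hc₁ : 1 < c) (hc₂ : c ≤ 2) :
    (∀ᶠ n : ℕ in Filter.atTop,
      DiffLocal.g n k (⌈(c - 1) * ((k : ℝ) - 1) / c⌉₊ ^ 2) ≠ ⊤) ∧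
    Asymptotics.IsLittleO Filter.atTop
      (fun n : ℕ => ((DiffLocal.g n k (⌈(c - 1) * ((k : ℝ) - 1) / c⌉₊ ^ 2)).toNat : ℝ))
      (fun n : ℕ => (n : ℝ) ^ c) := by
  obtain ⟨hD, hDc⟩ := DiffLocal.ceil_bounds hk hc₁ hc₂
  generalize ⌈(c - 1) * ((k : ℝ) - 1) / c⌉₊ = D at hD hDc
  have hk' : (1 : ℝ) ≤ k := by exact_mod_cast hk
  have hD' : (2 * D : ℝ) ≤ k := by exact_mod_cast hD
  have hkD : (0 : ℝ) < k - D := by linarith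
  obtain ⟨C, hC⟩ := DiffLocal.exists_g_le hk hD
  -- An interval of length about `n ^ b` with `b` just below `c` still has room for the set.
  obtain ⟨b, hb, hbc⟩ := exists_between (max_lt hc₁ ((div_lt_iff₀ hkD).2 hDc))
  obtain ⟨hb1, hbD⟩ := max_lt_iff.1 hb
  rw [div_lt_iff₀ hkD] at hbD
  have hmain : ∀ᶠ n : ℕ in Filter.atTop,
      DiffLocal.g n k (D ^ 2) ≤ (⌈(n : ℝ) ^ b⌉₊ : ℕ) ∧ 1 ≤ n := by
    filter_upwards [Filter.eventually_ge_atTop 1,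
      DiffLocal.eventually_le_rpow 2 (sub_pos.2 hb1),
      DiffLocal.eventually_le_rpow C (sub_pos.2 hbD)] with n hn h2 hCn
    have hn0 : (0 : ℝ) < n := by exact_mod_cast hn
    have hceil := Nat.le_ceil ((n : ℝ) ^ b)
    refine ⟨hC n _ hn ?_ ?_, hn⟩
    · have : (2 * n : ℝ) ≤ ⌈(n : ℝ) ^ b⌉₊ := by
        refine le_trans ?_ hceil
        calc (2 * n : ℝ) ≤ (n : ℝ) ^ (b - 1) * n := by gcongr
          _ = (n : ℝ) ^ b := by rw [Real.rpow_sub_one hn0.ne', div_mul_cancel₀ _ hn0.ne']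
      exact_mod_cast this
    · have : (C * n ^ (k - 1) : ℝ) ≤ (⌈(n : ℝ) ^ b⌉₊ : ℝ) ^ (k - D) := by
        calc (C * n ^ (k - 1) : ℝ)
            ≤ (n : ℝ) ^ (b * (k - D) - (k - 1)) * (n : ℝ) ^ (k - 1) := by gcongr
          _ = ((n : ℝ) ^ b) ^ (k - D) := by
            rw [← Real.rpow_natCast, ← Real.rpow_natCast ((n : ℝ) ^ b), ← Real.rpow_mul hn0.le,
              ← Real.rpow_add hn0, Nat.cast_sub hk, Nat.cast_sub (by omega : D ≤ k), Nat.cast_one,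
              sub_add_cancel]
          _ ≤ _ := by gcongr
      exact_mod_cast this
  refine ⟨hmain.mono fun n hn => ne_top_of_le_ne_top (ENat.natCast_ne_top _) hn.1, ?_⟩
  rw [Asymptotics.isLittleO_iff]
  intro ε hε
  filter_upwards [hmain, DiffLocal.eventually_le_rpow (2 / ε) (sub_pos.2 hbc)] with n hn hεn
  obtain ⟨hn, hn1⟩ := hn
  have hn0 : (0 : ℝ) < n := by exact_mod_cast hn1
  have hone : (1 : ℝ) ≤ (n : ℝ) ^ b :=
    Real.one_le_rpow (by exact_mod_cast hn1) (by linarith)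
  have h1 : (DiffLocal.g n k (D ^ 2)).toNat ≤ ⌈(n : ℝ) ^ b⌉₊ := ENat.toNat_le_of_le_natCast hn
  have h2 : ((DiffLocal.g n k (D ^ 2)).toNat : ℝ) ≤ ⌈(n : ℝ) ^ b⌉₊ := by exact_mod_cast h1
  have h3 := Nat.ceil_lt_add_one (zero_le_one.trans hone)
  rw [Real.norm_of_nonneg (Nat.cast_nonneg _), Real.norm_of_nonneg (by positivity)]
  calc ((DiffLocal.g n k (D ^ 2)).toNat : ℝ) ≤ 2 * (n : ℝ) ^ b := by linarith
    _ = ε * (2 / ε * (n : ℝ) ^ b) := by field_simp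
    _ ≤ ε * ((n : ℝ) ^ (c - b) * (n : ℝ) ^ b) := by gcongr
    _ = ε * (n : ℝ) ^ c := by rw [← Real.rpow_add hn0, sub_add_cancel]
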